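/- Let $(\mathcal C,\otimes,I,\sigma)$ be a symmetric monoidal category (associativity and unit isomorphisms are omitted from the notation). A *bialgebra* in $\mathcal C$ is a tuple $(B,m,u_B,\Delta,\epsilon_B)$ where $(B,m,u_B)$ is a unital, not necessarily associative, algebra, $(B,\Delta,\epsilon_B)$ is a coassociative counital coalgebra, and $\Delta$, $\epsilon_B$ are morphisms of algebras; it is *associative* if $m\cdot(m\otimes 1_B)=m\cdot(1_B\otimes m)$. A morphism of bialgebras is a morphism of $\mathcal C$ preserving $m$, $u$, $\Delta$ and $\epsilon$. A *split extension of bialgebras* consists of bialgebras $X,A,B$, morphisms of bialgebras $\kappa\colon X\to A$, $\alpha\colon A\to B$, $e\colon B\to A$, and a morphism $\lambda\colon A\to X$ of $\mathcal C$ such that 1. $\lambda\cdot\kappa=1_X$ and $\alpha\cdot e=1_B$; 2. $\lambda\cdot e=u_X\cdot\epsilon_B$ and $\alpha\cdot\kappa=u_B\cdot\epsilon_X$; 3. $m\cdot((\kappa\cdot\lambda)\otimes(e\cdot\alpha))\cdot\Delta=1_A$; 4. $\lambda\cdot m\cdot(\kappa\otimes e)=1_X\otimes\epsilon_B$; 5.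 $(1_B\otimes\lambda)\cdot(1_B\otimes m)\cdot(1_B\otimes e\otimes\kappa)\cdot(\Delta\otimes 1_X)=(1_B\otimes\lambda)\cdot(1_B\otimes m)\cdot(1_B\otimes e\otimes\kappa)\cdot(\sigma_{B,B}\otimes 1_X)\cdot(\Delta\otimes 1_X)$; 6. $m\cdot(m\otimes 1_A)\cdot(\kappa\otimes e\otimes 1_A)=m\cdot(1_A\otimes m)\cdot(\kappa\otimes e\otimes 1_A)$; 7. $m\cdot(m\otimes 1_A)\cdot(\kappa\otimes 1_A\otimes e)=m\cdot(1_A\otimes m)\cdot(\kappa\otimes 1_A\otimes e)$; 8. $m\cdot(m\otimes 1_A)\cdot(1_A\otimes\kappa\otimes e)=m\cdot(1_A\otimes m)\cdot(1_A\otimes\kappa\otimes e)$; 9. $\lambda$ is a morphism of coalgebras and $\lambda\cdot u_A=u_X$. A morphism of split extensions from $(X,A,B,\kappa,\alpha,e,\lambda)$ to $(X',A',B',\kappa',\alpha',e',\lambda')$ is a triple of bialgebra morphisms $g\colon B\to B'$, $v\colon X\to X'$, $p\colon A\to A'$ with $p\cdot\kappa=\kappa'\cdot v$, $g\cdot\alpha=\alpha'\cdot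 p$, $p\cdot e=e'\cdot g$ and $v\cdot\lambda=\lambda'\cdot p$. Let $\mathsf{SplitExt}(\mathsf{AssBiAlg}_{\mathcal C})$ be the full subcategory of the category of split extensions of bialgebras on those with $X$, $A$ and $B$ associative (conditions 6–8 then hold automatically). An *action* of a bialgebra $B$ on a bialgebra $X$ is a morphism $\triangleright\colon B\otimes X\to X$ of $\mathcal C$ such that $$\triangleright\cdot(u_B\otimes 1_X)=1_X,\qquad \triangleright\cdot(1_B\otimes u_X)=u_X\cdot\epsilon_B,$$ $$(1_B\otimes\triangleright)\cdot(\Delta\otimes 1_X)=(1_B\otimes\triangleright)\cdot(\sigma_{B,B}\otimes 1_X)\cdot(\Delta\otimes 1_X),$$ $$\epsilon_X\cdot\triangleright=\epsilon_B\otimes\epsilon_X,\qquad \Delta\cdot\triangleright=(\triangleright\otimes\triangleright)\cdot(1_B\otimes\sigma_{B,X}\otimes 1_X)\cdot(\Delta\otimes\Delta).$$ A morphism of actions from $\triangleright\colon B\otimes X\to X$ to $\triangleright'\colon B'\otimes X'\to X'$ is a pair of bialgebra morphisms $g\colon B\to B'$, $v\colon X\to X'$ with $v\cdot\triangleright=\triangleright'\cdot(g\otimes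 v)$. Let $\mathsf{Act}(\mathsf{AssBiAlg}_{\mathcal C})$ be the full subcategory of the category of actions of bialgebras on those actions for which $B$ and $X$ are associative and $$\triangleright\cdot(m\otimes 1_X)=\triangleright\cdot(1_B\otimes\triangleright),\qquad \triangleright\cdot(1_B\otimes m)=m\cdot(\triangleright\otimes\triangleright)\cdot(1_B\otimes\sigma_{B,X}\otimes 1_X)\cdot(\Delta\otimes 1_X\otimes 1_X).$$ **Corollary.** For every symmetric monoidal category $\mathcal C$, the categories $\mathsf{SplitExt}(\mathsf{AssBiAlg}_{\mathcal C})$ and $\mathsf{Act}(\mathsf{AssBiAlg}_{\mathcal C})$ are equivalent. -/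

import Mathlib

open CategoryTheory MonoidalCategory
open scoped ComonObj

universe v u

namespace BialgebraSplitExt

/-- A (not necessarily associative) bialgebra in a symmetric monoidal category: a unital, not
necessarily associative, algebra which is also a coassociative counital coalgebra (Mathlib's
`ComonObj`), such that the comultiplication and the counit are morphisms of algebras. -/
structure Bialg (C : Type u) [Category.{v} C] [MonoidalCategory C] [SymmetricCategory C] where
  /-- the underlying object -/
  X : C
  /-- the coalgebra structure -/
  [comon : ComonObj X]
  /-- the multiplication -/
  mul : X ⊗ X ⟶ X
  /-- the unit -/
  one : 𝟙_ C ⟶ X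
  one_mul : (one ▷ X) ≫ mul = (λ_ X).hom
  mul_one : (X ◁ one) ≫ mul = (ρ_ X).hom
  mul_comul : mul ≫ Δ[X] = (Δ[X] ⊗ₘ Δ[X]) ≫ tensorμ X X X X ≫ (mul ⊗ₘ mul)
  one_comul : one ≫ Δ[X] = (λ_ (𝟙_ C)).inv ≫ (one ⊗ₘ one)
  mul_counit : mul ≫ ε[X] = (ε[X] ⊗ₘ ε[X]) ≫ (λ_ (𝟙_ C)).hom
  one_counit : one ≫ ε[X] = 𝟙 (𝟙_ C)

attribute [instance] Bialg.comon

section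

variable {C : Type u} [Category.{v} C] [MonoidalCategory C] [SymmetricCategory C]

namespace Bialg

/-- A morphism of bialgebras: a morphism of algebras and of coalgebras. -/
@[ext]
structure Hom (M N : Bialg C) where
  /-- the underlying morphism -/
  hom : M.X ⟶ N.X
  isComonHom : IsComonHom hom
  mul_hom : M.mul ≫ hom = (hom ⊗ₘ hom) ≫ N.mul
  one_hom : M.one ≫ hom = N.one

attribute [instance] Hom.isComonHom

instance : Category (Bialg C) where
  Hom := Hom
  id M :=
    { hom := 𝟙 M.X
      isComonHom := inferInstance
      mul_hom := by simp
      one_hom := by simp }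
  comp f g :=
    { hom := f.hom ≫ g.hom
      isComonHom := inferInstance
      mul_hom := by
        rw [← Category.assoc, f.mul_hom, Category.assoc, g.mul_hom,
          ← MonoidalCategory.tensorHom_comp_tensorHom, Category.assoc]
      one_hom := by rw [← Category.assoc, f.one_hom, g.one_hom] }
  id_comp _ := Hom.ext (Category.id_comp _)
  comp_id _ := Hom.ext (Category.comp_id _)
  assoc _ _ _ := Hom.ext (Category.assoc _ _ _)

@[ext]
theorem hom_ext {M N : Bialg C} {f g : M ⟶ N} (h : f.hom = g.hom) : f = g :=
  Hom.ext h

@[simp]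
theorem id_hom (M : Bialg C) : (𝟙 M : M ⟶ M).hom = 𝟙 M.X := rfl

@[simp]
theorem comp_hom {M N P : Bialg C} (f : M ⟶ N) (g : N ⟶ P) :
    (f ≫ g).hom = f.hom ≫ g.hom := rfl

/-- The bialgebra `M` is associative. -/
def IsAssoc (M : Bialg C) : Prop :=
  (M.mul ▷ M.X) ≫ M.mul = (α_ M.X M.X M.X).hom ≫ (M.X ◁ M.mul) ≫ M.mul

end Bialg

end

/-- A split extension of (not necessarily associative) bialgebras: bialgebras `X`, `A`, `B`,
morphisms of bialgebras `κ : X ⟶ A`, `α : A ⟶ B`, `e : B ⟶ A`, and a morphism `lam : A ⟶ X` of the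
base category, subject to nine conditions. -/
structure SplitExt (C : Type u) [Category.{v} C] [MonoidalCategory C] [SymmetricCategory C] where
  X : Bialg C
  A : Bialg C
  B : Bialg C
  κ : X ⟶ A
  α : A ⟶ B
  e : B ⟶ A
  /-- the retraction of `κ`, a morphism in the base category -/
  lam : A.X ⟶ X.X
  κ_lam : κ.hom ≫ lam = 𝟙 X.X
  e_α : e ≫ α = 𝟙 B
  e_lam : e.hom ≫ lam = ε[B.X] ≫ X.one
  κ_α : κ.hom ≫ α.hom = ε[X.X] ≫ B.one
  decomposition : Δ[A.X] ≫ ((lam ≫ κ.hom) ⊗ₘ (α.hom ≫ e.hom)) ≫ A.mul = 𝟙 A.X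
  lam_mul : (κ.hom ⊗ₘ e.hom) ≫ A.mul ≫ lam = (X.X ◁ ε[B.X]) ≫ (ρ_ X.X).hom
  cocomm :
    (Δ[B.X] ▷ X.X) ≫ (α_ B.X B.X X.X).hom ≫
        (B.X ◁ (e.hom ⊗ₘ κ.hom)) ≫ (B.X ◁ A.mul) ≫ (B.X ◁ lam) =
      (Δ[B.X] ▷ X.X) ≫ ((β_ B.X B.X).hom ▷ X.X) ≫ (α_ B.X B.X X.X).hom ≫
        (B.X ◁ (e.hom ⊗ₘ κ.hom)) ≫ (B.X ◁ A.mul) ≫ (B.X ◁ lam)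
  assoc_κ_e_id :
    ((κ.hom ⊗ₘ e.hom) ⊗ₘ 𝟙 A.X) ≫ (A.mul ▷ A.X) ≫ A.mul =
      ((κ.hom ⊗ₘ e.hom) ⊗ₘ 𝟙 A.X) ≫ (α_ A.X A.X A.X).hom ≫ (A.X ◁ A.mul) ≫ A.mul
  assoc_κ_id_e :
    ((κ.hom ⊗ₘ 𝟙 A.X) ⊗ₘ e.hom) ≫ (A.mul ▷ A.X) ≫ A.mul =
      ((κ.hom ⊗ₘ 𝟙 A.X) ⊗ₘ e.hom) ≫ (α_ A.X A.X A.X).hom ≫ (A.X ◁ A.mul) ≫ A.mul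
  assoc_id_κ_e :
    ((𝟙 A.X ⊗ₘ κ.hom) ⊗ₘ e.hom) ≫ (A.mul ▷ A.X) ≫ A.mul =
      ((𝟙 A.X ⊗ₘ κ.hom) ⊗ₘ e.hom) ≫ (α_ A.X A.X A.X).hom ≫ (A.X ◁ A.mul) ≫ A.mul
  lam_isComonHom : IsComonHom lam
  one_lam : A.one ≫ lam = X.one

/-- An action of a bialgebra `B` on a bialgebra `X` (not necessarily associative). -/
structure Act (C : Type u) [Category.{v} C] [MonoidalCategory C] [SymmetricCategory C] where
  B : Bialg C
  X : Bialg C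
  /-- the action -/
  act : B.X ⊗ X.X ⟶ X.X
  one_act : (B.one ▷ X.X) ≫ act = (λ_ X.X).hom
  act_one : (B.X ◁ X.one) ≫ act = (ρ_ B.X).hom ≫ ε[B.X] ≫ X.one
  cocomm :
    (Δ[B.X] ▷ X.X) ≫ (α_ B.X B.X X.X).hom ≫ (B.X ◁ act) =
      (Δ[B.X] ▷ X.X) ≫ ((β_ B.X B.X).hom ▷ X.X) ≫ (α_ B.X B.X X.X).hom ≫ (B.X ◁ act)
  act_counit : act ≫ ε[X.X] = (ε[B.X] ⊗ₘ ε[X.X]) ≫ (λ_ (𝟙_ C)).hom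
  act_comul :
    act ≫ Δ[X.X] = (Δ[B.X] ⊗ₘ Δ[X.X]) ≫ tensorμ B.X B.X X.X X.X ≫ (act ⊗ₘ act)

section

variable {C : Type u} [Category.{v} C] [MonoidalCategory C] [SymmetricCategory C]

namespace SplitExt

/-- A morphism of split extensions: three morphisms of bialgebras commuting with `κ`, `α`, `e`
and `lam`. -/
@[ext]
structure Hom (S T : SplitExt C) where
  g : S.B ⟶ T.B
  v : S.X ⟶ T.X
  p : S.A ⟶ T.A
  κ_comm : S.κ ≫ p = v ≫ T.κ
  α_comm : S.α ≫ g = p ≫ T.α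
  e_comm : S.e ≫ p = g ≫ T.e
  lam_comm : S.lam ≫ v.hom = p.hom ≫ T.lam

instance : Category (SplitExt C) where
  Hom := Hom
  id S :=
    { g := 𝟙 S.B
      v := 𝟙 S.X
      p := 𝟙 S.A
      κ_comm := by simp
      α_comm := by simp
      e_comm := by simp
      lam_comm := by simp }
  comp f h :=
    { g := f.g ≫ h.g
      v := f.v ≫ h.v
      p := f.p ≫ h.p
      κ_comm := by rw [← Category.assoc, f.κ_comm, Category.assoc, h.κ_comm, Category.assoc]
      α_comm := by rw [← Category.assoc, f.α_comm, Category.assoc, h.α_comm, Category.assoc]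
      e_comm := by rw [← Category.assoc, f.e_comm, Category.assoc, h.e_comm, Category.assoc]
      lam_comm := by
        rw [Bialg.comp_hom, Bialg.comp_hom, ← Category.assoc, f.lam_comm, Category.assoc,
          h.lam_comm, Category.assoc] }
  id_comp _ := Hom.ext (Category.id_comp _) (Category.id_comp _) (Category.id_comp _)
  comp_id _ := Hom.ext (Category.comp_id _) (Category.comp_id _) (Category.comp_id _)
  assoc _ _ _ :=
    Hom.ext (Category.assoc _ _ _) (Category.assoc _ _ _) (Category.assoc _ _ _)

/-- The three bialgebras of the split extension are associative. -/
def isAssoc (C : Type u) [Category.{v} C] [MonoidalCategory C] [SymmetricCategory C] :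
    ObjectProperty (SplitExt C) :=
  fun S => S.X.IsAssoc ∧ S.A.IsAssoc ∧ S.B.IsAssoc

end SplitExt

namespace Act

/-- A morphism of actions: a pair of morphisms of bialgebras compatible with the actions. -/
@[ext]
structure Hom (S T : Act C) where
  g : S.B ⟶ T.B
  v : S.X ⟶ T.X
  act_comm : S.act ≫ v.hom = (g.hom ⊗ₘ v.hom) ≫ T.act

instance : Category (Act C) where
  Hom := Hom
  id S :=
    { g := 𝟙 S.B
      v := 𝟙 S.X
      act_comm := by simp }
  comp f h :=
    { g := f.g ≫ h.g
      v := f.v ≫ h.v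
      act_comm := by
        rw [Bialg.comp_hom, Bialg.comp_hom, ← Category.assoc, f.act_comm, Category.assoc,
          h.act_comm, ← MonoidalCategory.tensorHom_comp_tensorHom, Category.assoc] }
  id_comp _ := Hom.ext (Category.id_comp _) (Category.id_comp _)
  comp_id _ := Hom.ext (Category.comp_id _) (Category.comp_id _)
  assoc _ _ _ := Hom.ext (Category.assoc _ _ _) (Category.assoc _ _ _)

/-- The two bialgebras of the action are associative, and the action is compatible with both
multiplications. -/
def isAssoc (C : Type u) [Category.{v} C] [MonoidalCategory C] [SymmetricCategory C] :
    ObjectProperty (Act C) :=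
  fun S =>
    S.B.IsAssoc ∧ S.X.IsAssoc ∧
    (S.B.mul ▷ S.X.X) ≫ S.act = (α_ S.B.X S.B.X S.X.X).hom ≫ (S.B.X ◁ S.act) ≫ S.act ∧
    (S.B.X ◁ S.X.mul) ≫ S.act =
      (Δ[S.B.X] ▷ (S.X.X ⊗ S.X.X)) ≫ tensorμ S.B.X S.B.X S.X.X S.X.X ≫
        (S.act ⊗ₘ S.act) ≫ S.X.mul

end Act

end

/-- The category of split extensions of associative bialgebras, as a full subcategory of the
category of split extensions of bialgebras. -/
abbrev SplitExtAss (C : Type u) [Category.{v} C] [MonoidalCategory C] [SymmetricCategory C] :=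
  (SplitExt.isAssoc C).FullSubcategory

/-- The category of actions of associative bialgebras, as a full subcategory of the category of
actions of bialgebras. -/
abbrev ActAss (C : Type u) [Category.{v} C] [MonoidalCategory C] [SymmetricCategory C] :=
  (Act.isAssoc C).FullSubcategory

end BialgebraSplitExt

/-!
For an action of `B` on `X`, the smash product `X ⊗ B`, with multiplication
`(x ⊗ b)(y ⊗ c) = x (b₁ ▷ y) ⊗ b₂ c`, sits in a split extension `X ⟶ X ⊗ B ⟶ B` with retraction
`x ⊗ b ↦ ε b x` (`Act.toSplitExt`). Conversely, a split extension `X ⟶ A ⟶ B` induces the action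
`b ▷ x = λ (e b · κ x)` (`SplitExt.toAct`), and `x ⊗ b ↦ κ x · e b` is an isomorphism of bialgebras
from the smash product to `A` with inverse `a ↦ λ a₁ ⊗ α a₂` (`SplitExt.smashExtIso`). Starting from
an action one gets the same action back (`Act.actOfSmashIso`).

Nearly all morphisms involved are morphisms of coalgebras, and such a morphism into `P ⊗ Q` is
determined by its composites with the two projections `P ⊗ Q ⟶ P` and `P ⊗ Q ⟶ Q`
(`isComonHom_ext`). So the identities are checked on the components in `X` and `B`, where most
comultiplications have cancelled. The multiplication of the smash product is itself a morphism of
coalgebras because `swap : b ⊗ x ↦ (b₁ ▷ x) ⊗ b₂` is one; this is where the cocommutativity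
condition on actions enters, through the criterion `isComonHom_pair` for a pairing of morphisms of
coalgebras to be a morphism of coalgebras.

For a split extension of associative bialgebras, the axioms of an action follow from
`e b · κ x = κ (b₁ ▷ x) · e b₂` (`SplitExt.crossMul_eq`) together with `λ (κ x · a) = x · λ a` and
`λ (a · e b) = ε b · λ a` (`SplitExt.κ_mul_lam`, `SplitExt.mul_e_lam`).
-/

namespace BialgebraSplitExt

/-! ### Projections and pairings for coalgebras in a monoidal category -/

section Monoidal

variable {C : Type u} [Category.{v} C] [MonoidalCategory C]

attribute [local instance] ComonObj.instTensorUnit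

instance isComonHom_counit (P : C) [ComonObj P] : IsComonHom ε[P] where
  hom_comul := by simp [unitors_inv_equal]

/-- The first projection `P ⊗ Q ⟶ P` of a tensor product whose second factor is a coalgebra,
obtained by applying the counit of `Q`. -/
def fst (P Q : C) [ComonObj Q] : P ⊗ Q ⟶ P := P ◁ ε[Q] ≫ (ρ_ P).hom

/-- The second projection `P ⊗ Q ⟶ Q` of a tensor product whose first factor is a coalgebra,
obtained by applying the counit of `P`. -/
def snd (P Q : C) [ComonObj P] : P ⊗ Q ⟶ Q := ε[P] ▷ Q ≫ (λ_ Q).hom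

/-- The pairing of two morphisms out of a coalgebra: `x ↦ f x₁ ⊗ g x₂` in Sweedler notation.
It need not be a morphism of coalgebras, even if `f` and `g` are. -/
def pair {M P Q : C} [ComonObj M] (f : M ⟶ P) (g : M ⟶ Q) : M ⟶ P ⊗ Q := Δ[M] ≫ (f ⊗ₘ g)

theorem whiskerRight_fst {P P' : C} (f : P ⟶ P') (Q : C) [ComonObj Q] :
    f ▷ Q ≫ fst P' Q = fst P Q ≫ f := by
  simp [fst, ← whisker_exchange_assoc]

theorem whiskerLeft_fst (P : C) {Q Q' : C} [ComonObj Q] [ComonObj Q'] (g : Q ⟶ Q')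
    [IsComonHom g] : P ◁ g ≫ fst P Q' = fst P Q := by
  simp [fst, ← whiskerLeft_comp_assoc]

theorem whiskerLeft_snd (P : C) [ComonObj P] {Q Q' : C} (g : Q ⟶ Q') :
    P ◁ g ≫ snd P Q' = snd P Q ≫ g := by
  simp [snd, whisker_exchange_assoc]

theorem whiskerRight_snd {P P' : C} [ComonObj P] [ComonObj P'] (f : P ⟶ P') [IsComonHom f]
    (Q : C) : f ▷ Q ≫ snd P' Q = snd P Q := by
  simp [snd, ← comp_whiskerRight_assoc]

theorem tensorHom_fst {P P' Q Q' : C} [ComonObj Q] [ComonObj Q'] (f : P ⟶ P') (g : Q ⟶ Q')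
    [IsComonHom g] : (f ⊗ₘ g) ≫ fst P' Q' = fst P Q ≫ f := by
  rw [MonoidalCategory.tensorHom_def, Category.assoc, whiskerLeft_fst, whiskerRight_fst]

theorem tensorHom_snd {P P' Q Q' : C} [ComonObj P] [ComonObj P'] (f : P ⟶ P') (g : Q ⟶ Q')
    [IsComonHom f] : (f ⊗ₘ g) ≫ snd P' Q' = snd P Q ≫ g := by
  rw [MonoidalCategory.tensorHom_def', Category.assoc, whiskerRight_snd, whiskerLeft_snd]

theorem associator_inv_fst (P Q R : C) [ComonObj R] :
    (α_ P Q R).inv ≫ fst (P ⊗ Q) R = P ◁ fst Q R := by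
  simp [fst]

theorem associator_hom_snd (P Q R : C) [ComonObj P] :
    (α_ P Q R).hom ≫ snd P (Q ⊗ R) = snd P Q ▷ R := by
  simp [snd]

theorem associator_inv_fst_whiskerRight (P Q R : C) [ComonObj Q] :
    (α_ P Q R).inv ≫ fst P Q ▷ R = P ◁ snd Q R := by
  simp [fst, snd]

@[simp]
theorem pair_fst {M P Q : C} [ComonObj M] [ComonObj Q] (f : M ⟶ P) (g : M ⟶ Q) [IsComonHom g] :
    pair f g ≫ fst P Q = f := by
  simp [pair, fst, ← id_tensorHom]

@[simp]
theorem pair_snd {M P Q : C} [ComonObj M] [ComonObj P] (f : M ⟶ P) (g : M ⟶ Q) [IsComonHom f] :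
    pair f g ≫ snd P Q = g := by
  simp [pair, snd, ← tensorHom_id]

/-- By coassociativity, the fourfold comultiplication may be computed by splitting the two
middle factors off last, which is the form in which they can be interchanged. -/
theorem comul_comul_comul (M : C) [ComonObj M] :
    Δ[M] ≫ (Δ[M] ⊗ₘ Δ[M]) =
      Δ[M] ≫ M ◁ Δ[M] ≫ M ◁ Δ[M] ▷ M ⊗≫ 𝟙 ((M ⊗ M) ⊗ M ⊗ M) := by
  calc
    _ = (Δ[M] ≫ Δ[M] ▷ M) ≫ (M ⊗ M) ◁ Δ[M] := by rw [MonoidalCategory.tensorHom_def]; simp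
    _ = Δ[M] ≫ M ◁ (Δ[M] ≫ M ◁ Δ[M]) ⊗≫ 𝟙 ((M ⊗ M) ⊗ M ⊗ M) := by
      rw [ComonObj.comul_assoc_flip]; monoidal
    _ = Δ[M] ≫ M ◁ ((Δ[M] ≫ Δ[M] ▷ M) ≫ (α_ M M M).hom) ⊗≫ 𝟙 ((M ⊗ M) ⊗ M ⊗ M) := by
      rw [Category.assoc Δ[M], ComonObj.comul_assoc]
    _ = _ := by monoidal

end Monoidal

section Symmetric

variable {C : Type u} [Category.{v} C] [MonoidalCategory C] [SymmetricCategory C]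

attribute [local instance] ComonObj.instTensorUnit

/-! ### Morphisms of coalgebras into tensor products -/

instance isComonHom_tensorHom {P Q P' Q' : C} [ComonObj P] [ComonObj Q] [ComonObj P'] [ComonObj Q']
    (f : P ⟶ P') (g : Q ⟶ Q') [IsComonHom f] [IsComonHom g] : IsComonHom (f ⊗ₘ g) where
  hom_counit := by simp
  hom_comul := by
    simp only [Comon.tensorObj_comul, Category.assoc]
    rw [← tensorμ_natural]
    simp only [tensorHom_comp_tensorHom_assoc, IsComonHom.hom_comul]

instance isComonHom_whiskerLeft (P : C) {Q Q' : C} [ComonObj P] [ComonObj Q] [ComonObj Q']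
    (g : Q ⟶ Q') [IsComonHom g] : IsComonHom (P ◁ g) := by
  rw [← id_tensorHom]; infer_instance

instance isComonHom_whiskerRight {P P' : C} (Q : C) [ComonObj P] [ComonObj P'] [ComonObj Q]
    (f : P ⟶ P') [IsComonHom f] : IsComonHom (f ▷ Q) := by
  rw [← tensorHom_id]; infer_instance

instance isComonHom_associator_hom (P Q R : C) [ComonObj P] [ComonObj Q] [ComonObj R] :
    IsComonHom (α_ P Q R).hom where
  hom_counit := by
    simp only [Comon.tensorObj_counit]
    monoidal
  hom_comul := by
    have := tensor_associativity P P Q Q R R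
    simp only [Comon.tensorObj_comul, Category.assoc] at this ⊢
    calc
      _ = ((Δ[P] ⊗ₘ Δ[Q]) ⊗ₘ Δ[R]) ≫ (α_ (P ⊗ P) (Q ⊗ Q) (R ⊗ R)).hom ≫
          ((P ⊗ P) ◁ tensorμ Q Q R R) ≫ tensorμ P P (Q ⊗ R) (Q ⊗ R) := by
        rw [associator_naturality_assoc, ← id_tensorHom, tensorHom_comp_tensorHom_assoc,
          Category.comp_id]
      _ = _ := by
        rw [← this, ← tensorHom_id, tensorHom_comp_tensorHom_assoc, Category.comp_id]

instance isComonHom_leftUnitor_hom (P : C) [ComonObj P] : IsComonHom (λ_ P).hom where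
  hom_counit := by simp
  hom_comul := by
    have := tensor_left_unitality P P
    rw [Comon.tensorObj_comul, MonoidalCategory.tensorHom_def', ComonObj.instTensorUnit_comul]
    simp only [Category.assoc]
    rw [← this, leftUnitor_naturality]

instance isComonHom_rightUnitor_hom (P : C) [ComonObj P] : IsComonHom (ρ_ P).hom where
  hom_counit := by simp [unitors_equal]
  hom_comul := by
    have := tensor_right_unitality P P
    rw [Comon.tensorObj_comul, MonoidalCategory.tensorHom_def, ComonObj.instTensorUnit_comul]
    simp only [Category.assoc]
    rw [← this, rightUnitor_naturality]

instance isComonHom_fst (P Q : C) [ComonObj P] [ComonObj Q] : IsComonHom (fst P Q) := by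
  unfold fst; infer_instance

instance isComonHom_snd (P Q : C) [ComonObj P] [ComonObj Q] : IsComonHom (snd P Q) := by
  unfold snd; infer_instance

theorem comul_fst_snd (P Q : C) [ComonObj P] [ComonObj Q] :
    Δ[P ⊗ Q] ≫ (fst P Q ⊗ₘ snd P Q) = 𝟙 (P ⊗ Q) := by
  have h := Comon.tensorObj_comul P Q
  have : (fst P Q ⊗ₘ snd P Q) = ((𝟙 P ⊗ₘ ε[Q]) ⊗ₘ (ε[P] ⊗ₘ 𝟙 Q)) ≫ ((ρ_ P).hom ⊗ₘ (λ_ Q).hom) := by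
    simp [fst, snd]
  rw [h, this, Category.assoc, ← tensorμ_natural_assoc, tensorHom_comp_tensorHom_assoc]
  simp only [ComonObj.comul_counit_hom, ComonObj.counit_comul_hom, Category.id_comp]
  simp only [tensorμ, braiding_tensorUnit_left, Category.assoc]
  monoidal

/-- A morphism of coalgebras into a tensor product is determined by its two projections. This is
what replaces diagram chases below: an identity between such morphisms is checked componentwise. -/
theorem isComonHom_ext {M P Q : C} [ComonObj M] [ComonObj P] [ComonObj Q]
    {f g : M ⟶ P ⊗ Q} [IsComonHom f] [IsComonHom g]
    (h₁ : f ≫ fst P Q = g ≫ fst P Q) (h₂ : f ≫ snd P Q = g ≫ snd P Q) : f = g := by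
  have key : ∀ (h : M ⟶ P ⊗ Q) [IsComonHom h], h = Δ[M] ≫ ((h ≫ fst P Q) ⊗ₘ (h ≫ snd P Q)) := by
    intro h _
    rw [← tensorHom_comp_tensorHom, ← IsComonHom.hom_comul_assoc, comul_fst_snd, Category.comp_id]
  rw [key f, key g, h₁, h₂]

/-- The pairing of two morphisms of coalgebras whose images cocommute, that is
`f x₁ ⊗ g x₂ = f x₂ ⊗ g x₁`, is a morphism of coalgebras. -/
theorem isComonHom_pair {M P Q : C} [ComonObj M] [ComonObj P] [ComonObj Q]
    (f : M ⟶ P) (g : M ⟶ Q) [IsComonHom f] [IsComonHom g]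
    (h : pair f g = pair g f ≫ (β_ Q P).hom) : IsComonHom (pair f g) where
  hom_counit := by
    simp [pair, unitors_equal]
  hom_comul := by
    have h' : Δ[M] ≫ (g ⊗ₘ f) ≫ (β_ Q P).hom = Δ[M] ≫ (f ⊗ₘ g) := by
      simpa [pair] using h.symm
    have h2 : Δ[M] ≫ (f ⊗ₘ g) ≫ (β_ P Q).hom = Δ[M] ≫ (g ⊗ₘ f) := by
      rw [← reassoc_of% h']; simp
    -- the first copy of `f` and the last copy of `g` are applied after the middle two
    have e : ((f ⊗ₘ g) ⊗ₘ (f ⊗ₘ g)) =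
        𝟙 _ ⊗≫ M ◁ (g ⊗ₘ f) ▷ M ⊗≫ f ▷ (Q ⊗ P ⊗ M) ⊗≫ (P ⊗ Q ⊗ P) ◁ g ⊗≫ 𝟙 _ := by
      simp only [MonoidalCategory.tensorHom_def]
      calc
        _ = 𝟙 _ ⊗≫ f ▷ (M ⊗ (M ⊗ M)) ⊗≫ P ◁ g ▷ (M ⊗ M) ⊗≫ (P ⊗ Q) ◁ (f ▷ M) ⊗≫
            (P ⊗ Q ⊗ P) ◁ g ⊗≫ 𝟙 _ := by
          monoidal
        _ = 𝟙 _ ⊗≫ (f ▷ (M ⊗ (M ⊗ M)) ≫ P ◁ (g ▷ (M ⊗ M) ≫ Q ◁ (f ▷ M))) ⊗≫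
            (P ⊗ Q ⊗ P) ◁ g ⊗≫ 𝟙 _ := by
          monoidal
        _ = 𝟙 _ ⊗≫ (M ◁ (g ▷ (M ⊗ M) ≫ Q ◁ (f ▷ M)) ≫ f ▷ _) ⊗≫
            (P ⊗ Q ⊗ P) ◁ g ⊗≫ 𝟙 _ := by
          rw [whisker_exchange]
        _ = _ := by monoidal
    have e' : ((f ⊗ₘ f) ⊗ₘ (g ⊗ₘ g)) ≫ tensorμ P P Q Q =
        𝟙 _ ⊗≫ M ◁ ((f ⊗ₘ g) ≫ (β_ P Q).hom) ▷ M ⊗≫ f ▷ (Q ⊗ P ⊗ M) ⊗≫ (P ⊗ Q ⊗ P) ◁ g ⊗≫ 𝟙 _ := by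
      rw [tensorμ_natural, e]
      simp only [BraidedCategory.braiding_naturality]
      simp only [tensorμ]
      monoidal
    unfold pair
    calc
      _ = (Δ[M] ≫ (Δ[M] ⊗ₘ Δ[M])) ≫ ((f ⊗ₘ f) ⊗ₘ (g ⊗ₘ g)) ≫ tensorμ P P Q Q := by
        simp only [Comon.tensorObj_comul, Category.assoc]
        simp only [tensorHom_comp_tensorHom_assoc, IsComonHom.hom_comul]
      _ = Δ[M] ≫ M ◁ Δ[M] ⊗≫ M ◁ (Δ[M] ≫ (f ⊗ₘ g) ≫ (β_ P Q).hom) ▷ M ⊗≫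
          f ▷ (Q ⊗ P ⊗ M) ⊗≫ (P ⊗ Q ⊗ P) ◁ g ⊗≫ 𝟙 _ := by
        rw [comul_comul_comul, e']
        monoidal
      _ = Δ[M] ≫ M ◁ Δ[M] ⊗≫ M ◁ (Δ[M] ≫ (g ⊗ₘ f)) ▷ M ⊗≫
          f ▷ (Q ⊗ P ⊗ M) ⊗≫ (P ⊗ Q ⊗ P) ◁ g ⊗≫ 𝟙 _ := by rw [h2]
      _ = (Δ[M] ≫ (Δ[M] ⊗ₘ Δ[M])) ≫ ((f ⊗ₘ g) ⊗ₘ (f ⊗ₘ g)) := by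
        rw [comul_comul_comul, e]
        monoidal
      _ = _ := by
        simp only [Category.assoc, tensorHom_comp_tensorHom]

theorem associator_hom_fst (P Q R : C) [ComonObj Q] [ComonObj R] :
    (α_ P Q R).hom ≫ fst P (Q ⊗ R) = fst (P ⊗ Q) R ≫ fst P Q := by
  simp only [fst, Comon.tensorObj_counit, MonoidalCategory.tensorHom_def']
  monoidal

theorem associator_inv_snd (P Q R : C) [ComonObj P] [ComonObj Q] :
    (α_ P Q R).inv ≫ snd (P ⊗ Q) R = snd P (Q ⊗ R) ≫ snd Q R := by
  simp only [snd, Comon.tensorObj_counit, MonoidalCategory.tensorHom_def]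
  monoidal

/-- Sweedler form: `p ⊗ q ↦ p₁ ⊗ f (p₂ ⊗ q)`. -/
theorem pair_fst_left {P Q R : C} [ComonObj P] [ComonObj Q] (f : P ⊗ Q ⟶ R) :
    pair (fst P Q) f = Δ[P] ▷ Q ≫ (α_ P P Q).hom ≫ P ◁ f := by
  have e : (fst P Q ⊗ₘ f) = ((𝟙 P ⊗ₘ ε[Q]) ⊗ₘ (𝟙 P ⊗ₘ 𝟙 Q)) ≫ ((ρ_ P).hom ⊗ₘ f) := by
    rw [tensorHom_comp_tensorHom]; simp [fst]
  rw [pair, Comon.tensorObj_comul, e, Category.assoc, ← tensorμ_natural_assoc,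
    tensorHom_comp_tensorHom_assoc, ComonObj.counit_comul_hom]
  simp only [tensorμ, braiding_tensorUnit_right, MonoidalCategory.tensorHom_def]
  monoidal

/-- Sweedler form: `p ⊗ q ↦ f (p₁ ⊗ q) ⊗ p₂`. -/
theorem pair_fst_right {P Q R : C} [ComonObj P] [ComonObj Q] (f : P ⊗ Q ⟶ R) :
    pair f (fst P Q) =
      Δ[P] ▷ Q ≫ (α_ P P Q).hom ≫ P ◁ (β_ P Q).hom ≫ (α_ P Q P).inv ≫ f ▷ P := by
  have e : (f ⊗ₘ fst P Q) = ((𝟙 P ⊗ₘ 𝟙 Q) ⊗ₘ (𝟙 P ⊗ₘ ε[Q])) ≫ (f ⊗ₘ (ρ_ P).hom) := by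
    rw [tensorHom_comp_tensorHom]; simp [fst]
  rw [pair, Comon.tensorObj_comul, e, Category.assoc, ← tensorμ_natural_assoc,
    tensorHom_comp_tensorHom_assoc, ComonObj.comul_counit_hom]
  simp only [tensorμ, MonoidalCategory.tensorHom_def]
  monoidal

/-- Sweedler form: `p ⊗ q ↦ p₂ ⊗ f (p₁ ⊗ q)`. -/
theorem pair_fst_right_comp_braiding {P Q R : C} [ComonObj P] [ComonObj Q] (f : P ⊗ Q ⟶ R) :
    pair f (fst P Q) ≫ (β_ R P).hom =
      Δ[P] ▷ Q ≫ (β_ P P).hom ▷ Q ≫ (α_ P P Q).hom ≫ P ◁ f := by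
  rw [pair_fst_right]
  simp only [Category.assoc, BraidedCategory.braiding_naturality_left,
    BraidedCategory.braiding_tensor_left_hom]
  simp [← MonoidalCategory.whiskerLeft_comp_assoc]

/-! ### Bialgebras -/

instance Bialg.isComonHom_mul (M : Bialg C) : IsComonHom M.mul where
  hom_counit := M.mul_counit
  hom_comul := by
    rw [M.mul_comul, Comon.tensorObj_comul, Category.assoc]

instance Bialg.isComonHom_one (M : Bialg C) : IsComonHom M.one where
  hom_counit := M.one_counit
  hom_comul := M.one_comul

theorem Bialg.one_tensor_one_mul (M : Bialg C) : (M.one ⊗ₘ M.one) ≫ M.mul = (λ_ _).hom ≫ M.one := by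
  rw [MonoidalCategory.tensorHom_def', Category.assoc, M.one_mul, leftUnitor_naturality]

/-- Associativity of the convolution-type product `(f ⊗ g) ≫ mul` of morphisms into an
associative bialgebra. -/
theorem Bialg.IsAssoc.tensorHom_mul {M : Bialg C} (hM : M.IsAssoc) {P Q R : C} (f : P ⟶ M.X)
    (g : Q ⟶ M.X) (h : R ⟶ M.X) :
    (f ⊗ₘ ((g ⊗ₘ h) ≫ M.mul)) ≫ M.mul =
      (α_ P Q R).inv ≫ (((f ⊗ₘ g) ≫ M.mul) ⊗ₘ h) ≫ M.mul := by
  have e₁ : (f ⊗ₘ ((g ⊗ₘ h) ≫ M.mul)) = (f ⊗ₘ (g ⊗ₘ h)) ≫ M.X ◁ M.mul := by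
    rw [← id_tensorHom, tensorHom_comp_tensorHom, Category.comp_id]
  have e₂ : (((f ⊗ₘ g) ≫ M.mul) ⊗ₘ h) = ((f ⊗ₘ g) ⊗ₘ h) ≫ M.mul ▷ M.X := by
    rw [← tensorHom_id, tensorHom_comp_tensorHom, Category.comp_id]
  have hM' : M.mul ▷ M.X ≫ M.mul = _ := hM
  rw [e₁, e₂, Category.assoc, Category.assoc, hM', associator_naturality_assoc,
    Iso.inv_hom_id_assoc]

theorem Bialg.IsAssoc.mul_tensorHom {M : Bialg C} (hM : M.IsAssoc) {P Q R : C} (f : P ⟶ M.X)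
    (g : Q ⟶ M.X) (h : R ⟶ M.X) :
    (((f ⊗ₘ g) ≫ M.mul) ⊗ₘ h) ≫ M.mul =
      (α_ P Q R).hom ≫ (f ⊗ₘ ((g ⊗ₘ h) ≫ M.mul)) ≫ M.mul := by
  rw [hM.tensorHom_mul, Iso.hom_inv_id_assoc]

/-! ### The smash product of an action -/

namespace Act

variable (T : Act C)

instance isComonHom_act : IsComonHom T.act where
  hom_counit := T.act_counit
  hom_comul := by
    rw [T.act_comul, Comon.tensorObj_comul, Category.assoc]

/-- The morphism `b ⊗ x ↦ (b₁ ▷ x) ⊗ b₂` which moves an element of `B` past one of `X` in the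
smash product. -/
def swap : T.B.X ⊗ T.X.X ⟶ T.X.X ⊗ T.B.X := pair T.act (fst T.B.X T.X.X)

/-- The criterion `isComonHom_pair` for `swap` is exactly the cocommutativity condition on actions,
up to a braiding. -/
instance isComonHom_swap : IsComonHom T.swap := by
  apply isComonHom_pair
  rw [← cancel_mono (β_ T.X.X T.B.X).hom, pair_fst_right_comp_braiding, ← T.cocomm, pair_fst_left]
  simp only [Category.assoc, SymmetricCategory.symmetry, Category.comp_id]

theorem swap_fst : T.swap ≫ fst T.X.X T.B.X = T.act := pair_fst _ _

theorem swap_snd : T.swap ≫ snd T.X.X T.B.X = fst T.B.X T.X.X := pair_snd _ _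

/-- The multiplication `(x ⊗ b)(y ⊗ c) = x (b₁ ▷ y) ⊗ b₂ c` of the smash product. -/
def smashMul : (T.X.X ⊗ T.B.X) ⊗ (T.X.X ⊗ T.B.X) ⟶ T.X.X ⊗ T.B.X :=
  (α_ _ _ _).hom ≫ T.X.X ◁ ((α_ _ _ _).inv ≫ T.swap ▷ T.B.X ≫ (α_ _ _ _).hom) ≫ (α_ _ _ _).inv ≫
    (T.X.mul ⊗ₘ T.B.mul)

instance isComonHom_smashMul : IsComonHom T.smashMul := by
  unfold smashMul; infer_instance

/-- The unit `1 ⊗ 1` of the smash product. -/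
def smashOne : 𝟙_ C ⟶ T.X.X ⊗ T.B.X := (λ_ _).inv ≫ (T.X.one ⊗ₘ T.B.one)

instance isComonHom_smashOne : IsComonHom T.smashOne := by
  unfold smashOne; infer_instance

/-- The action `(x ⊗ b) ⊗ y ↦ x (b ▷ y)` of the smash product on `X`. It is the `X`-component of
the multiplication of the smash product. -/
def smashAct : (T.X.X ⊗ T.B.X) ⊗ T.X.X ⟶ T.X.X :=
  (α_ _ _ _).hom ≫ T.X.X ◁ T.act ≫ T.X.mul

theorem smashMul_fst :
    T.smashMul ≫ fst T.X.X T.B.X = (T.X.X ⊗ T.B.X) ◁ fst T.X.X T.B.X ≫ T.smashAct := by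
  simp only [smashMul, smashAct, MonoidalCategory.tensorHom_def, Category.assoc]
  rw [whiskerLeft_fst, whiskerRight_fst, reassoc_of% associator_inv_fst]
  simp only [← whiskerLeft_comp_assoc, Category.assoc]
  rw [associator_hom_fst, reassoc_of% whiskerRight_fst, swap_fst, reassoc_of% associator_inv_fst]
  simp

theorem smashMul_snd :
    T.smashMul ≫ snd T.X.X T.B.X = (snd T.X.X T.B.X ⊗ₘ snd T.X.X T.B.X) ≫ T.B.mul := by
  simp only [smashMul, MonoidalCategory.tensorHom_def, Category.assoc]
  rw [whiskerLeft_snd, reassoc_of% whiskerRight_snd, reassoc_of% associator_inv_snd,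
    reassoc_of% whiskerLeft_snd, reassoc_of% associator_hom_snd]
  simp only [Category.assoc]
  rw [reassoc_of% associator_hom_snd]
  simp only [← comp_whiskerRight_assoc, swap_snd]
  rw [reassoc_of% associator_inv_fst_whiskerRight]

theorem smashOne_fst : T.smashOne ≫ fst T.X.X T.B.X = T.X.one := by
  simp only [smashOne, MonoidalCategory.tensorHom_def, Category.assoc]
  rw [whiskerLeft_fst]
  simp [fst, unitors_inv_equal]

theorem smashOne_snd : T.smashOne ≫ snd T.X.X T.B.X = T.B.one := by
  simp only [smashOne, MonoidalCategory.tensorHom_def', Category.assoc]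
  rw [whiskerRight_snd]
  simp [snd]

theorem one_smashAct : T.smashOne ▷ T.X.X ≫ T.smashAct = (λ_ T.X.X).hom := by
  calc
    _ = 𝟙 _ ⊗≫ T.X.one ▷ (𝟙_ C ⊗ T.X.X) ≫ T.X.X ◁ (T.B.one ▷ T.X.X ≫ T.act) ≫ T.X.mul := by
      simp only [smashOne, smashAct, MonoidalCategory.tensorHom_def]
      monoidal
    _ = 𝟙 _ ⊗≫ T.X.one ▷ T.X.X ≫ T.X.mul := by
      rw [T.one_act, ← whisker_exchange_assoc]
      monoidal
    _ = _ := by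
      rw [T.X.one_mul]
      monoidal

theorem smashAct_one : (T.X.X ⊗ T.B.X) ◁ T.X.one ≫ T.smashAct = (ρ_ _).hom ≫ fst T.X.X T.B.X := by
  calc
    _ = 𝟙 _ ⊗≫ T.X.X ◁ (T.B.X ◁ T.X.one ≫ T.act) ≫ T.X.mul := by
      simp only [smashAct]
      monoidal
    _ = 𝟙 _ ⊗≫ T.X.X ◁ ε[T.B.X] ≫ (T.X.X ◁ T.X.one ≫ T.X.mul) := by
      rw [T.act_one]
      monoidal
    _ = _ := by
      rw [T.X.mul_one, fst]
      monoidal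

/-- The right-hand side of the compatibility of an action with the multiplication of `X`,
`(b₁ ▷ x)(b₂ ▷ y)`, written without a braiding other than the one hidden in `swap`. -/
theorem comul_tensorμ_act_act_mul :
    Δ[T.B.X] ▷ (T.X.X ⊗ T.X.X) ≫ tensorμ T.B.X T.B.X T.X.X T.X.X ≫ (T.act ⊗ₘ T.act) ≫ T.X.mul =
      (α_ _ _ _).inv ≫ T.swap ▷ T.X.X ≫ (α_ _ _ _).hom ≫ T.X.X ◁ T.act ≫ T.X.mul := by
  rw [swap, pair_fst_right, tensorμ]
  simp only [MonoidalCategory.tensorHom_def]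
  monoidal

/-- `X` is a module over the smash product. By `smashMul_fst` this is the `X`-component of the
associativity of the smash product. -/
theorem mul_smashAct (h : isAssoc C T) :
    T.smashMul ▷ T.X.X ≫ T.smashAct =
      (α_ _ _ _).hom ≫ (T.X.X ⊗ T.B.X) ◁ T.smashAct ≫ T.smashAct := by
  have hX : T.X.mul ▷ T.X.X ≫ T.X.mul = _ := h.2.1
  have hB := h.2.2.1
  calc
    _ = 𝟙 _ ⊗≫ T.X.X ◁ T.swap ▷ T.B.X ▷ T.X.X ⊗≫ (T.X.mul ▷ ((T.B.X ⊗ T.B.X) ⊗ T.X.X) ≫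
          T.X.X ◁ (T.B.mul ▷ T.X.X ≫ T.act)) ≫ T.X.mul := by
      simp only [smashMul, smashAct, MonoidalCategory.tensorHom_def]
      monoidal
    _ = 𝟙 _ ⊗≫ T.X.X ◁ T.swap ▷ T.B.X ▷ T.X.X ⊗≫ (T.X.X ⊗ T.X.X) ◁ (T.B.X ◁ T.act ≫ T.act) ≫
          (T.X.mul ▷ T.X.X ≫ T.X.mul) := by
      rw [hB, ← whisker_exchange]
      monoidal
    _ = 𝟙 _ ⊗≫ T.X.X ◁ (T.swap ▷ (T.B.X ⊗ T.X.X) ≫ (T.X.X ⊗ T.B.X) ◁ T.act) ⊗≫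
          T.X.X ◁ (T.X.X ◁ T.act ≫ T.X.mul) ≫ T.X.mul := by
      rw [hX]
      monoidal
    _ = 𝟙 _ ⊗≫ T.X.X ◁ (T.B.X ◁ T.X.X ◁ T.act ≫ ((α_ _ _ _).inv ≫ T.swap ▷ T.X.X ≫
          (α_ _ _ _).hom ≫ T.X.X ◁ T.act ≫ T.X.mul)) ≫ T.X.mul := by
      rw [← whisker_exchange]
      monoidal
    _ = _ := by
      rw [← T.comul_tensorμ_act_act_mul, ← h.2.2.2]
      simp only [smashAct]
      monoidal

/-- The smash product bialgebra of an action of `B` on `X`: the coalgebra `X ⊗ B` with the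
multiplication `smashMul`. No associativity is needed for this. -/
def smash : Bialg C where
  X := T.X.X ⊗ T.B.X
  mul := T.smashMul
  one := T.smashOne
  one_mul := by
    apply isComonHom_ext
    · rw [Category.assoc, smashMul_fst, ← whisker_exchange_assoc, one_smashAct]
      simp
    · rw [Category.assoc, smashMul_snd, ← Category.assoc, ← tensorHom_id,
        tensorHom_comp_tensorHom, smashOne_snd, MonoidalCategory.tensorHom_def']
      simp [T.B.one_mul]
  mul_one := by
    apply isComonHom_ext
    · rw [Category.assoc, smashMul_fst, ← whiskerLeft_comp_assoc, smashOne_fst, smashAct_one]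
    · rw [Category.assoc, smashMul_snd, ← Category.assoc, ← id_tensorHom,
        tensorHom_comp_tensorHom, smashOne_snd, MonoidalCategory.tensorHom_def]
      simp [T.B.mul_one]
  mul_comul := by
    rw [IsComonHom.hom_comul, Comon.tensorObj_comul (T.X.X ⊗ T.B.X), Category.assoc]
  one_comul := IsComonHom.hom_comul T.smashOne
  mul_counit := IsComonHom.hom_counit T.smashMul
  one_counit := IsComonHom.hom_counit T.smashOne

theorem smash_isAssoc (h : isAssoc C T) : T.smash.IsAssoc := by
  have hB : T.B.mul ▷ T.B.X ≫ T.B.mul = _ := h.1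
  change T.smashMul ▷ (T.X.X ⊗ T.B.X) ≫ T.smashMul =
    (α_ _ _ _).hom ≫ (T.X.X ⊗ T.B.X) ◁ T.smashMul ≫ T.smashMul
  apply isComonHom_ext
  · simp only [Category.assoc, smashMul_fst]
    rw [← whisker_exchange_assoc, mul_smashAct T h, ← whiskerLeft_comp_assoc, smashMul_fst]
    simp
  · simp only [Category.assoc, smashMul_snd]
    rw [← tensorHom_id, ← id_tensorHom, tensorHom_comp_tensorHom_assoc,
      tensorHom_comp_tensorHom_assoc, smashMul_snd]
    calc
      _ = ((snd T.X.X T.B.X ⊗ₘ snd T.X.X T.B.X) ⊗ₘ snd T.X.X T.B.X) ≫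
          T.B.mul ▷ T.B.X ≫ T.B.mul := by
        rw [← tensorHom_id, tensorHom_comp_tensorHom_assoc]; simp
      _ = _ := by
        rw [hB, associator_naturality_assoc, ← id_tensorHom, tensorHom_comp_tensorHom_assoc]; simp

/-! ### The split extension of an action -/

/-- The inclusion `x ↦ x ⊗ 1` into the smash product. -/
def inl : T.X.X ⟶ T.X.X ⊗ T.B.X := (ρ_ _).inv ≫ T.X.X ◁ T.B.one

/-- The inclusion `b ↦ 1 ⊗ b` into the smash product. -/
def inr : T.B.X ⟶ T.X.X ⊗ T.B.X := (λ_ _).inv ≫ T.X.one ▷ T.B.X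

instance isComonHom_inl : IsComonHom T.inl := by unfold inl; infer_instance

instance isComonHom_inr : IsComonHom T.inr := by unfold inr; infer_instance

theorem inl_fst : T.inl ≫ fst T.X.X T.B.X = 𝟙 _ := by
  rw [inl, Category.assoc, whiskerLeft_fst]
  simp [fst]

theorem inl_snd : T.inl ≫ snd T.X.X T.B.X = ε[T.X.X] ≫ T.B.one := by
  rw [inl, Category.assoc, whiskerLeft_snd]
  simp only [snd, unitors_equal, Category.assoc, rightUnitor_naturality_assoc,
    Iso.inv_hom_id_assoc]

theorem inr_fst : T.inr ≫ fst T.X.X T.B.X = ε[T.B.X] ≫ T.X.one := by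
  rw [inr, Category.assoc, whiskerRight_fst]
  simp only [fst, ← unitors_equal, Category.assoc, leftUnitor_naturality_assoc,
    Iso.inv_hom_id_assoc]

theorem inr_snd : T.inr ≫ snd T.X.X T.B.X = 𝟙 _ := by
  rw [inr, Category.assoc, whiskerRight_snd]
  simp [snd]

theorem inl_smashAct : T.inl ▷ T.X.X ≫ T.smashAct = T.X.mul := by
  calc
    _ = 𝟙 _ ⊗≫ T.X.X ◁ (T.B.one ▷ T.X.X ≫ T.act) ≫ T.X.mul := by
      rw [inl, smashAct]; monoidal
    _ = _ := by
      rw [T.one_act]; monoidal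

theorem inr_smashAct : T.inr ▷ T.X.X ≫ T.smashAct = T.act := by
  calc
    _ = 𝟙 _ ⊗≫ (T.X.one ▷ (T.B.X ⊗ T.X.X) ≫ T.X.X ◁ T.act) ≫ T.X.mul := by
      rw [inr, smashAct]; monoidal
    _ = 𝟙 _ ⊗≫ T.act ⊗≫ (T.X.one ▷ T.X.X ≫ T.X.mul) := by
      rw [← whisker_exchange]; monoidal
    _ = _ := by
      rw [T.X.one_mul]; monoidal

theorem tensorHom_smashMul_fst {P Q : C} (f : P ⟶ T.X.X ⊗ T.B.X) (g : Q ⟶ T.X.X ⊗ T.B.X) :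
    (f ⊗ₘ g) ≫ T.smashMul ≫ fst T.X.X T.B.X =
      P ◁ (g ≫ fst T.X.X T.B.X) ≫ f ▷ T.X.X ≫ T.smashAct := by
  rw [smashMul_fst, MonoidalCategory.tensorHom_def', Category.assoc, ← whisker_exchange_assoc,
    whiskerLeft_comp, Category.assoc]

theorem tensorHom_smashMul_snd {P Q : C} (f : P ⟶ T.X.X ⊗ T.B.X) (g : Q ⟶ T.X.X ⊗ T.B.X) :
    (f ⊗ₘ g) ≫ T.smashMul ≫ snd T.X.X T.B.X =
      ((f ≫ snd T.X.X T.B.X) ⊗ₘ (g ≫ snd T.X.X T.B.X)) ≫ T.B.mul := by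
  rw [smashMul_snd, tensorHom_comp_tensorHom_assoc]

/-- In the smash product, `(x ⊗ 1)(1 ⊗ b) = x ⊗ b`. -/
theorem inl_inr_smashMul : (T.inl ⊗ₘ T.inr) ≫ T.smashMul = 𝟙 _ := by
  apply isComonHom_ext
  · rw [Category.assoc, tensorHom_smashMul_fst, inr_fst, whiskerLeft_comp, Category.assoc,
      whisker_exchange_assoc, smashAct_one, rightUnitor_naturality_assoc, inl_fst]
    simp [fst]
  · rw [Category.assoc, tensorHom_smashMul_snd, inl_snd, inr_snd, tensorHom_id, comp_whiskerRight,
      Category.assoc, T.B.one_mul]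
    simp [snd]

/-- The `X`-component of `(1 ⊗ b)(x ⊗ 1)` is `b ▷ x`: the action is recovered from the smash
product. -/
theorem inr_inl_smashMul_fst : (T.inr ⊗ₘ T.inl) ≫ T.smashMul ≫ fst T.X.X T.B.X = T.act := by
  rw [tensorHom_smashMul_fst, inl_fst, inr_smashAct]
  simp

theorem mul_inl : T.X.mul ≫ T.inl = (T.inl ⊗ₘ T.inl) ≫ T.smashMul := by
  apply isComonHom_ext
  · simp only [Category.assoc]
    rw [tensorHom_smashMul_fst, inl_fst, inl_smashAct]
    simp
  · simp only [Category.assoc]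
    rw [tensorHom_smashMul_snd, inl_snd, ← tensorHom_comp_tensorHom, Category.assoc,
      T.B.one_tensor_one_mul, ← Category.assoc, T.X.mul_counit, Category.assoc]

theorem one_inl : T.X.one ≫ T.inl = T.smashOne := by
  apply isComonHom_ext
  · rw [Category.assoc, inl_fst, Category.comp_id, smashOne_fst]
  · rw [Category.assoc, inl_snd, ← Category.assoc, T.X.one_counit, Category.id_comp, smashOne_snd]

theorem mul_inr : T.B.mul ≫ T.inr = (T.inr ⊗ₘ T.inr) ≫ T.smashMul := by
  apply isComonHom_ext
  · simp only [Category.assoc]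
    rw [tensorHom_smashMul_fst, inr_fst, inr_smashAct, whiskerLeft_comp, Category.assoc, T.act_one,
      ← Category.assoc, T.B.mul_counit]
    simp only [MonoidalCategory.tensorHom_def', unitors_equal, Category.assoc,
      rightUnitor_naturality_assoc]
  · simp only [Category.assoc]
    rw [tensorHom_smashMul_snd, inr_snd]
    simp

theorem one_inr : T.B.one ≫ T.inr = T.smashOne := by
  apply isComonHom_ext
  · rw [Category.assoc, inr_fst, ← Category.assoc, T.B.one_counit, Category.id_comp, smashOne_fst]
  · rw [Category.assoc, inr_snd, Category.comp_id, smashOne_snd]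

/-- `Act.inl` as a morphism of bialgebras. -/
def smashInl : T.X ⟶ T.smash where
  hom := T.inl
  isComonHom := T.isComonHom_inl
  mul_hom := T.mul_inl
  one_hom := T.one_inl

/-- `Act.inr` as a morphism of bialgebras. -/
def smashInr : T.B ⟶ T.smash where
  hom := T.inr
  isComonHom := T.isComonHom_inr
  mul_hom := T.mul_inr
  one_hom := T.one_inr

/-- The projection of the smash product onto `B` as a morphism of bialgebras. -/
def smashSnd : T.smash ⟶ T.B where
  hom := snd T.X.X T.B.X
  isComonHom := isComonHom_snd T.X.X T.B.X
  mul_hom := T.smashMul_snd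
  one_hom := T.smashOne_snd

/-- The split extension `X ⟶ X ⊗ B ⟶ B` given by the smash product. -/
def toSplitExt (h : isAssoc C T) : SplitExt C where
  X := T.X
  A := T.smash
  B := T.B
  κ := T.smashInl
  α := T.smashSnd
  e := T.smashInr
  lam := fst T.X.X T.B.X
  κ_lam := T.inl_fst
  e_α := Bialg.hom_ext T.inr_snd
  e_lam := T.inr_fst
  κ_α := T.inl_snd
  decomposition := by
    change Δ[T.X.X ⊗ T.B.X] ≫ ((fst T.X.X T.B.X ≫ T.inl) ⊗ₘ (snd T.X.X T.B.X ≫ T.inr)) ≫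
      T.smashMul = 𝟙 _
    rw [← tensorHom_comp_tensorHom, Category.assoc, inl_inr_smashMul, Category.comp_id,
      comul_fst_snd]
  lam_mul := by
    change (T.inl ⊗ₘ T.inr) ≫ T.smashMul ≫ fst T.X.X T.B.X = _
    rw [← Category.assoc, inl_inr_smashMul, Category.id_comp, fst]
  cocomm := by
    have := T.cocomm
    simp only [← T.inr_inl_smashMul_fst, whiskerLeft_comp] at this
    exact this
  assoc_κ_e_id := by rw [T.smash_isAssoc h]
  assoc_κ_id_e := by rw [T.smash_isAssoc h]
  assoc_id_κ_e := by rw [T.smash_isAssoc h]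
  lam_isComonHom := isComonHom_fst T.X.X T.B.X
  one_lam := T.smashOne_fst

end Act

/-! ### The action induced by a split extension -/

namespace SplitExt

variable (S : SplitExt C)

instance isComonHom_lam : IsComonHom S.lam := S.lam_isComonHom

/-- The action `b ▷ x = λ (e b · κ x)` induced by a split extension. -/
def act : S.B.X ⊗ S.X.X ⟶ S.X.X := (S.e.hom ⊗ₘ S.κ.hom) ≫ S.A.mul ≫ S.lam

instance isComonHom_act : IsComonHom S.act := by unfold act; infer_instance

/-- The object of `Act C` with underlying action `SplitExt.act`. -/
abbrev toAct : Act C where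
  B := S.B
  X := S.X
  act := S.act
  one_act := by
    rw [act, whiskerRight_comp_tensorHom_assoc, S.e.one_hom, MonoidalCategory.tensorHom_def',
      Category.assoc, ← Category.assoc (_ ▷ _), S.A.one_mul, leftUnitor_naturality_assoc, S.κ_lam,
      Category.comp_id]
  act_one := by
    rw [act, whiskerLeft_comp_tensorHom_assoc, S.κ.one_hom, MonoidalCategory.tensorHom_def,
      Category.assoc, ← Category.assoc (_ ◁ _), S.A.mul_one, rightUnitor_naturality_assoc, S.e_lam]
  cocomm := by
    have := S.cocomm
    simp only [← whiskerLeft_comp] at this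
    exact this
  act_counit := by
    rw [IsComonHom.hom_counit, Comon.tensorObj_counit]
  act_comul := by
    rw [IsComonHom.hom_comul, Comon.tensorObj_comul, Category.assoc]

/-- The morphism `x ⊗ b ↦ κ x · e b` from `X ⊗ B` to the middle term of a split extension. -/
def ofSmash : S.X.X ⊗ S.B.X ⟶ S.A.X := (S.κ.hom ⊗ₘ S.e.hom) ≫ S.A.mul

instance isComonHom_ofSmash : IsComonHom S.ofSmash := by unfold ofSmash; infer_instance

theorem ofSmash_lam : S.ofSmash ≫ S.lam = fst S.X.X S.B.X := by
  rw [ofSmash, Category.assoc, S.lam_mul, fst]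

theorem e_hom_α_hom : S.e.hom ≫ S.α.hom = 𝟙 _ := congrArg Bialg.Hom.hom S.e_α

theorem ofSmash_α : S.ofSmash ≫ S.α.hom = snd S.X.X S.B.X := by
  rw [ofSmash, Category.assoc, S.α.mul_hom, tensorHom_comp_tensorHom_assoc, S.κ_α, S.e_hom_α_hom,
    tensorHom_id, comp_whiskerRight, Category.assoc, S.B.one_mul, snd]

/-- The middle term of a split extension is `X ⊗ B`, with inverse isomorphism
`a ↦ λ a₁ ⊗ α a₂`. That `ofSmash` is a morphism of coalgebras reduces one of the two identities to
the components `ofSmash_lam` and `ofSmash_α`; the other one is the axiom `decomposition`. -/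
@[simps]
def smashIso : S.X.X ⊗ S.B.X ≅ S.A.X where
  hom := S.ofSmash
  inv := pair S.lam S.α.hom
  hom_inv_id := by
    rw [pair, IsComonHom.hom_comul_assoc, tensorHom_comp_tensorHom, ofSmash_lam, ofSmash_α,
      comul_fst_snd]
  inv_hom_id := by
    rw [pair, ofSmash, Category.assoc, tensorHom_comp_tensorHom_assoc, S.decomposition]

instance isComonHom_smashIso_hom : IsComonHom S.smashIso.hom := S.isComonHom_ofSmash

/-- The morphism `b ⊗ x ↦ e b · κ x`. -/
def crossMul : S.B.X ⊗ S.X.X ⟶ S.A.X := (S.e.hom ⊗ₘ S.κ.hom) ≫ S.A.mul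

instance isComonHom_crossMul : IsComonHom S.crossMul := by unfold crossMul; infer_instance

theorem crossMul_lam : S.crossMul ≫ S.lam = S.act := by
  rw [crossMul, act, Category.assoc]

theorem crossMul_α : S.crossMul ≫ S.α.hom = fst S.B.X S.X.X := by
  rw [crossMul, Category.assoc, S.α.mul_hom, tensorHom_comp_tensorHom_assoc, S.κ_α, S.e_hom_α_hom,
    id_tensorHom, whiskerLeft_comp, Category.assoc, S.B.mul_one, fst]

/-- The commutation rule `e b · κ x = κ (b₁ ▷ x) · e b₂`. -/
theorem crossMul_eq : S.crossMul = pair S.act (fst S.B.X S.X.X) ≫ S.ofSmash := by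
  rw [← cancel_mono S.smashIso.inv, Category.assoc, ← smashIso_hom, Iso.hom_inv_id,
    Category.comp_id, smashIso_inv, pair, IsComonHom.hom_comul_assoc, tensorHom_comp_tensorHom,
    crossMul_lam, crossMul_α, pair]

variable {S}

/-- `λ (κ x · a) = x · λ a`. -/
theorem κ_mul_lam (h : isAssoc C S) :
    S.κ.hom ▷ S.A.X ≫ S.A.mul ≫ S.lam = S.X.X ◁ S.lam ≫ S.X.mul := by
  have e : S.X.X ◁ S.smashIso.inv ≫ (S.κ.hom ⊗ₘ S.ofSmash) = S.κ.hom ▷ S.A.X := by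
    rw [← id_tensorHom, tensorHom_comp_tensorHom, ← smashIso_hom, Iso.inv_hom_id, Category.id_comp,
      tensorHom_id]
  calc
    _ = S.X.X ◁ S.smashIso.inv ≫ ((S.κ.hom ⊗ₘ S.ofSmash) ≫ S.A.mul) ≫ S.lam := by
      rw [← e]; simp only [Category.assoc]
    _ = S.X.X ◁ S.smashIso.inv ≫ (α_ _ _ _).inv ≫ S.X.mul ▷ S.B.X ≫ S.ofSmash ≫ S.lam := by
      rw [ofSmash, h.2.1.tensorHom_mul, ← S.κ.mul_hom]
      simp only [Category.assoc]
      rw [whiskerRight_comp_tensorHom_assoc]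
    _ = _ := by
      rw [ofSmash_lam, whiskerRight_fst, reassoc_of% associator_inv_fst, ← whiskerLeft_comp_assoc,
        smashIso_inv, pair_fst]

/-- `λ (a · e b) = ε b · λ a`. -/
theorem mul_e_lam (h : isAssoc C S) :
    S.A.X ◁ S.e.hom ≫ S.A.mul ≫ S.lam = fst S.A.X S.B.X ≫ S.lam := by
  have e : S.smashIso.inv ▷ S.B.X ≫ (S.ofSmash ⊗ₘ S.e.hom) = S.A.X ◁ S.e.hom := by
    rw [← tensorHom_id, tensorHom_comp_tensorHom, ← smashIso_hom, Iso.inv_hom_id, Category.id_comp,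
      id_tensorHom]
  calc
    _ = S.smashIso.inv ▷ S.B.X ≫ ((S.ofSmash ⊗ₘ S.e.hom) ≫ S.A.mul) ≫ S.lam := by
      rw [← e]; simp only [Category.assoc]
    _ = S.smashIso.inv ▷ S.B.X ≫ (α_ _ _ _).hom ≫ S.X.X ◁ S.B.mul ≫ S.ofSmash ≫ S.lam := by
      rw [ofSmash, h.2.1.mul_tensorHom, ← S.e.mul_hom]
      simp only [Category.assoc]
      rw [whiskerLeft_comp_tensorHom_assoc]
    _ = _ := by
      rw [ofSmash_lam, whiskerLeft_fst, associator_hom_fst,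
        reassoc_of% whiskerRight_fst, smashIso_inv, pair_fst]

/-- `λ (κ x · e b · κ y) = x (b ▷ y)`. -/
theorem ofSmash_κ_mul_lam (h : isAssoc C S) :
    (S.ofSmash ⊗ₘ S.κ.hom) ≫ S.A.mul ≫ S.lam =
      (α_ _ _ _).hom ≫ S.X.X ◁ S.act ≫ S.X.mul := by
  calc
    _ = (α_ _ _ _).hom ≫ S.X.X ◁ S.crossMul ≫ S.κ.hom ▷ S.A.X ≫ S.A.mul ≫ S.lam := by
      rw [← Category.assoc, ofSmash, h.2.1.mul_tensorHom, ← crossMul,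
        MonoidalCategory.tensorHom_def']
      simp only [Category.assoc]
    _ = _ := by
      rw [κ_mul_lam h, ← whiskerLeft_comp_assoc, crossMul_lam]

/-- `(b c) ▷ x = b ▷ (c ▷ x)`. -/
theorem mul_act (h : isAssoc C S) :
    S.B.mul ▷ S.X.X ≫ S.act = (α_ _ _ _).hom ≫ S.B.X ◁ S.act ≫ S.act := by
  calc
    _ = (((S.e.hom ⊗ₘ S.e.hom) ≫ S.A.mul ⊗ₘ S.κ.hom) ≫ S.A.mul) ≫ S.lam := by
      rw [← S.e.mul_hom, act, whiskerRight_comp_tensorHom_assoc, Category.assoc]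
    _ = (α_ _ _ _).hom ≫ S.B.X ◁ pair S.act (fst S.B.X S.X.X) ≫
          ((S.e.hom ⊗ₘ S.ofSmash) ≫ S.A.mul) ≫ S.lam := by
      rw [h.2.1.mul_tensorHom, ← crossMul, crossMul_eq]
      simp only [Category.assoc]
      rw [whiskerLeft_comp_tensorHom_assoc]
    _ = (α_ _ _ _).hom ≫ S.B.X ◁ pair S.act (fst S.B.X S.X.X) ≫ (α_ _ _ _).inv ≫
          S.crossMul ▷ S.B.X ≫ S.A.X ◁ S.e.hom ≫ S.A.mul ≫ S.lam := by
      rw [ofSmash, h.2.1.tensorHom_mul, ← crossMul, MonoidalCategory.tensorHom_def]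
      simp only [Category.assoc]
    _ = _ := by
      rw [mul_e_lam h, reassoc_of% whiskerRight_fst, crossMul_lam,
        reassoc_of% associator_inv_fst, ← whiskerLeft_comp_assoc, pair_fst]

/-- `b ▷ (x y) = (b₁ ▷ x)(b₂ ▷ y)`, with the right-hand side in the form given by
`Act.comul_tensorμ_act_act_mul`. -/
theorem act_mul (h : isAssoc C S) :
    S.B.X ◁ S.X.mul ≫ S.act = (α_ _ _ _).inv ≫ pair S.act (fst S.B.X S.X.X) ▷ S.X.X ≫
      (α_ _ _ _).hom ≫ S.X.X ◁ S.act ≫ S.X.mul := by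
  calc
    _ = ((S.e.hom ⊗ₘ (S.κ.hom ⊗ₘ S.κ.hom) ≫ S.A.mul) ≫ S.A.mul) ≫ S.lam := by
      rw [← S.κ.mul_hom, act, whiskerLeft_comp_tensorHom_assoc, Category.assoc]
    _ = (α_ _ _ _).inv ≫ pair S.act (fst S.B.X S.X.X) ▷ S.X.X ≫
          (S.ofSmash ⊗ₘ S.κ.hom) ≫ S.A.mul ≫ S.lam := by
      rw [h.2.1.tensorHom_mul, ← crossMul, crossMul_eq]
      simp only [Category.assoc]
      rw [whiskerRight_comp_tensorHom_assoc]
    _ = _ := by rw [ofSmash_κ_mul_lam h]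

theorem toAct_isAssoc (h : isAssoc C S) : Act.isAssoc C S.toAct := by
  refine ⟨h.2.2, h.1, mul_act h, ?_⟩
  rw [S.toAct.comul_tensorμ_act_act_mul]
  exact act_mul h

/-- `λ (κ x · e b · κ y · e c)` is the `X`-component of the product `(x ⊗ b)(y ⊗ c)` in the smash
product. -/
theorem ofSmash_mul_lam (h : isAssoc C S) :
    (S.ofSmash ⊗ₘ S.ofSmash) ≫ S.A.mul ≫ S.lam =
      (S.X.X ⊗ S.B.X) ◁ fst S.X.X S.B.X ≫ S.toAct.smashAct := by
  calc
    _ = (α_ _ _ _).inv ≫ ((S.ofSmash ⊗ₘ S.κ.hom) ≫ S.A.mul) ▷ S.B.X ≫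
          S.A.X ◁ S.e.hom ≫ S.A.mul ≫ S.lam := by
      nth_rw 2 [ofSmash]
      rw [← Category.assoc, h.2.1.tensorHom_mul, MonoidalCategory.tensorHom_def]
      simp only [Category.assoc]
    _ = _ := by
      rw [mul_e_lam h, reassoc_of% whiskerRight_fst, Category.assoc, ofSmash_κ_mul_lam h,
        reassoc_of% associator_inv_fst, Act.smashAct]

theorem smashMul_ofSmash (h : isAssoc C S) :
    S.toAct.smashMul ≫ S.ofSmash = (S.ofSmash ⊗ₘ S.ofSmash) ≫ S.A.mul := by
  rw [← smashIso_hom, ← Iso.eq_comp_inv, smashIso_hom]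
  apply isComonHom_ext
  · simp only [Category.assoc]
    rw [smashIso_inv, pair_fst, ofSmash_mul_lam h, Act.smashMul_fst]
  · simp only [Category.assoc]
    rw [smashIso_inv, pair_snd, S.α.mul_hom, tensorHom_comp_tensorHom_assoc, ofSmash_α,
      Act.smashMul_snd]

theorem smashOne_ofSmash : S.toAct.smashOne ≫ S.ofSmash = S.A.one := by
  rw [Act.smashOne, ofSmash, Category.assoc, tensorHom_comp_tensorHom_assoc, S.κ.one_hom,
    S.e.one_hom, S.A.one_tensor_one_mul, Iso.inv_hom_id_assoc]

end SplitExt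

/-! ### The equivalence -/

/-- A morphism of bialgebras which is invertible in `C` is an isomorphism of bialgebras. -/
def Bialg.isoMk {M N : Bialg C} (f : M ⟶ N) (i : M.X ≅ N.X) (h : i.hom = f.hom) : M ≅ N where
  hom := f
  inv :=
    { hom := i.inv
      isComonHom := by
        have : IsComonHom i.hom := h ▸ f.isComonHom
        infer_instance
      mul_hom := by
        rw [Iso.comp_inv_eq, Category.assoc, h, f.mul_hom, tensorHom_comp_tensorHom_assoc, ← h,
          Iso.inv_hom_id, id_tensorHom_id, Category.id_comp]
      one_hom := by
        rw [Iso.comp_inv_eq, h, f.one_hom] }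
  hom_inv_id := Bialg.hom_ext (by simp [← h])
  inv_hom_id := Bialg.hom_ext (by simp [← h])

/-- A morphism of split extensions whose three components are invertible is an isomorphism. -/
def SplitExt.isoMk {S T : SplitExt C} (f : S ⟶ T) (g : S.B ≅ T.B) (v : S.X ≅ T.X) (p : S.A ≅ T.A)
    (hg : g.hom = f.g) (hv : v.hom = f.v) (hp : p.hom = f.p) : S ≅ T where
  hom := f
  inv :=
    { g := g.inv
      v := v.inv
      p := p.inv
      κ_comm := by rw [Iso.comp_inv_eq, Category.assoc, hp, f.κ_comm, ← hv, Iso.inv_hom_id_assoc]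
      α_comm := by rw [Iso.comp_inv_eq, Category.assoc, hg, f.α_comm, ← hp, Iso.inv_hom_id_assoc]
      e_comm := by rw [Iso.comp_inv_eq, Category.assoc, hp, f.e_comm, ← hg, Iso.inv_hom_id_assoc]
      lam_comm := by
        have h₁ : p.inv.hom ≫ p.hom.hom = 𝟙 _ := congrArg Bialg.Hom.hom p.inv_hom_id
        have h₂ : v.hom.hom ≫ v.inv.hom = 𝟙 _ := congrArg Bialg.Hom.hom v.hom_inv_id
        calc
          _ = p.inv.hom ≫ (p.hom.hom ≫ T.lam) ≫ v.inv.hom := by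
            rw [Category.assoc, reassoc_of% h₁]
          _ = _ := by
            rw [hp, ← f.lam_comm, ← hv, Category.assoc, h₂, Category.comp_id] }
  hom_inv_id := Hom.ext (hg ▸ g.hom_inv_id) (hv ▸ v.hom_inv_id) (hp ▸ p.hom_inv_id)
  inv_hom_id := Hom.ext (hg ▸ g.inv_hom_id) (hv ▸ v.inv_hom_id) (hp ▸ p.inv_hom_id)

variable (C) in
/-- The functor sending a split extension to its induced action. -/
def SplitExt.actFunctor : SplitExt C ⥤ Act C where
  obj := toAct
  map {S T} f :=
    { g := f.g
      v := f.v
      act_comm := by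
        have h₁ : S.κ.hom ≫ f.p.hom = f.v.hom ≫ T.κ.hom := congrArg Bialg.Hom.hom f.κ_comm
        have h₂ : S.e.hom ≫ f.p.hom = f.g.hom ≫ T.e.hom := congrArg Bialg.Hom.hom f.e_comm
        change S.act ≫ f.v.hom = (f.g.hom ⊗ₘ f.v.hom) ≫ T.act
        rw [act, act, Category.assoc, Category.assoc, f.lam_comm, ← Category.assoc S.A.mul,
          f.p.mul_hom, Category.assoc, tensorHom_comp_tensorHom_assoc, h₁, h₂,
          tensorHom_comp_tensorHom_assoc] }

theorem Act.smashAct_natural {S T : Act C} (f : S ⟶ T) :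
    S.smashAct ≫ f.v.hom = ((f.v.hom ⊗ₘ f.g.hom) ⊗ₘ f.v.hom) ≫ T.smashAct := by
  rw [smashAct, smashAct, associator_naturality_assoc]
  simp only [Category.assoc]
  rw [f.v.mul_hom, tensorHom_comp_whiskerLeft_assoc, whiskerLeft_comp_tensorHom_assoc, f.act_comm]

/-- The morphism of smash products `v ⊗ g` induced by a morphism of actions `(g, v)`. -/
def Act.smashMap {S T : Act C} (f : S ⟶ T) : S.smash ⟶ T.smash where
  hom := f.v.hom ⊗ₘ f.g.hom
  isComonHom := isComonHom_tensorHom _ _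
  mul_hom := by
    change S.smashMul ≫ (f.v.hom ⊗ₘ f.g.hom) =
      ((f.v.hom ⊗ₘ f.g.hom) ⊗ₘ (f.v.hom ⊗ₘ f.g.hom)) ≫ T.smashMul
    apply isComonHom_ext
    · simp only [Category.assoc]
      rw [tensorHom_fst, tensorHom_smashMul_fst, tensorHom_fst, reassoc_of% smashMul_fst,
        smashAct_natural, MonoidalCategory.tensorHom_def' _ f.v.hom, whiskerLeft_comp]
      simp only [Category.assoc]
    · simp only [Category.assoc]
      rw [tensorHom_snd, tensorHom_smashMul_snd, tensorHom_snd, reassoc_of% smashMul_snd,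
        f.g.mul_hom, tensorHom_comp_tensorHom_assoc]
  one_hom := by
    change S.smashOne ≫ (f.v.hom ⊗ₘ f.g.hom) = T.smashOne
    rw [smashOne, smashOne, Category.assoc, tensorHom_comp_tensorHom, f.v.one_hom, f.g.one_hom]

variable (C) in
/-- The functor sending an action to its smash product split extension. -/
def Act.smashFunctor : ActAss C ⥤ SplitExt C where
  obj T := T.obj.toSplitExt T.property
  map {S T} f :=
    { g := f.hom.g
      v := f.hom.v
      p := smashMap f.hom
      κ_comm := by
        apply Bialg.hom_ext
        change S.obj.inl ≫ (f.hom.v.hom ⊗ₘ f.hom.g.hom) = f.hom.v.hom ≫ T.obj.inl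
        simp only [inl, Category.assoc]
        rw [whiskerLeft_comp_tensorHom, f.hom.g.one_hom, MonoidalCategory.tensorHom_def,
          rightUnitor_inv_naturality_assoc]
      α_comm := Bialg.hom_ext (tensorHom_snd f.hom.v.hom f.hom.g.hom).symm
      e_comm := by
        apply Bialg.hom_ext
        change S.obj.inr ≫ (f.hom.v.hom ⊗ₘ f.hom.g.hom) = f.hom.g.hom ≫ T.obj.inr
        simp only [inr, Category.assoc]
        rw [whiskerRight_comp_tensorHom, f.hom.v.one_hom, MonoidalCategory.tensorHom_def',
          leftUnitor_inv_naturality_assoc]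
      lam_comm := (tensorHom_fst f.hom.v.hom f.hom.g.hom).symm }
  map_id S := SplitExt.Hom.ext rfl rfl (Bialg.hom_ext (id_tensorHom_id _ _))
  map_comp f g := SplitExt.Hom.ext rfl rfl (Bialg.hom_ext (tensorHom_comp_tensorHom _ _ _ _).symm)

variable (C) in
/-- `SplitExt.actFunctor` restricted to the associative case. -/
def SplitExt.toActAss : SplitExtAss C ⥤ ActAss C :=
  (Act.isAssoc C).lift ((SplitExt.isAssoc C).ι ⋙ actFunctor C) fun S => toAct_isAssoc S.property

variable (C) in
/-- `Act.smashFunctor` with values in split extensions of associative bialgebras. -/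
def Act.toSplitExtAss : ActAss C ⥤ SplitExtAss C :=
  (SplitExt.isAssoc C).lift (Act.smashFunctor C)
    fun T => ⟨T.property.2.1, T.obj.smash_isAssoc T.property, T.property.1⟩

/-- `SplitExt.ofSmash` as a morphism of bialgebras out of the smash product. -/
def SplitExt.bialgOfSmash (S : SplitExt C) (h : isAssoc C S) : S.toAct.smash ⟶ S.A where
  hom := S.ofSmash
  isComonHom := S.isComonHom_ofSmash
  mul_hom := smashMul_ofSmash h
  one_hom := smashOne_ofSmash

/-- A split extension of associative bialgebras is isomorphic to the smash product extension of
its induced action. -/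
def SplitExt.smashExtIso (S : SplitExt C) (h : isAssoc C S) :
    S.toAct.toSplitExt (toAct_isAssoc h) ≅ S :=
  isoMk
    { g := 𝟙 S.B
      v := 𝟙 S.X
      p := S.bialgOfSmash h
      κ_comm := by
        apply Bialg.hom_ext
        change S.toAct.inl ≫ S.ofSmash = 𝟙 _ ≫ S.κ.hom
        simp only [Act.inl, ofSmash, Category.assoc]
        rw [whiskerLeft_comp_tensorHom_assoc, S.e.one_hom, MonoidalCategory.tensorHom_def,
          Category.assoc, S.A.mul_one, rightUnitor_naturality, Iso.inv_hom_id_assoc,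
          Category.id_comp]
      α_comm := Bialg.hom_ext (by
        change snd S.X.X S.B.X ≫ 𝟙 _ = S.ofSmash ≫ S.α.hom
        rw [ofSmash_α, Category.comp_id])
      e_comm := by
        apply Bialg.hom_ext
        change S.toAct.inr ≫ S.ofSmash = 𝟙 _ ≫ S.e.hom
        simp only [Act.inr, ofSmash, Category.assoc]
        rw [whiskerRight_comp_tensorHom_assoc, S.κ.one_hom, MonoidalCategory.tensorHom_def',
          Category.assoc, S.A.one_mul, leftUnitor_naturality, Iso.inv_hom_id_assoc,
          Category.id_comp]
      lam_comm := by
        change fst S.X.X S.B.X ≫ 𝟙 _ = S.ofSmash ≫ S.lam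
        rw [ofSmash_lam, Category.comp_id] }
    (Iso.refl _) (Iso.refl _) (Bialg.isoMk (S.bialgOfSmash h) S.smashIso rfl) rfl rfl rfl

/-- The action induced by a smash product extension is the original one. -/
def Act.actOfSmashIso (T : Act C) (h : isAssoc C T) : (T.toSplitExt h).toAct ≅ T where
  hom :=
    { g := 𝟙 T.B
      v := 𝟙 T.X
      act_comm := by
        change ((T.inr ⊗ₘ T.inl) ≫ T.smashMul ≫ fst T.X.X T.B.X) ≫ 𝟙 _ = (𝟙 _ ⊗ₘ 𝟙 _) ≫ T.act
        rw [inr_inl_smashMul_fst]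
        simp }
  inv :=
    { g := 𝟙 T.B
      v := 𝟙 T.X
      act_comm := by
        change T.act ≫ 𝟙 _ = (𝟙 _ ⊗ₘ 𝟙 _) ≫ ((T.inr ⊗ₘ T.inl) ≫ T.smashMul ≫ fst T.X.X T.B.X)
        rw [inr_inl_smashMul_fst]
        simp }
  hom_inv_id := Hom.ext (Category.id_comp _) (Category.id_comp _)
  inv_hom_id := Hom.ext (Category.id_comp _) (Category.id_comp _)

variable (C) in
/-- Split extensions of associative bialgebras are equivalent to actions of associative
bialgebras. -/
def splitExtEquivAct : SplitExtAss C ≌ ActAss C :=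
  CategoryTheory.Equivalence.mk (SplitExt.toActAss C) (Act.toSplitExtAss C)
    (NatIso.ofComponents (fun S => (SplitExt.isAssoc C).isoMk (S.obj.smashExtIso S.property))
      (by
        intro S T f
        apply ObjectProperty.hom_ext
        refine SplitExt.Hom.ext ?_ ?_ (Bialg.hom_ext ?_)
        · exact (Category.comp_id _).trans (Category.id_comp _).symm
        · exact (Category.comp_id _).trans (Category.id_comp _).symm
        · change (f.hom.v.hom ⊗ₘ f.hom.g.hom) ≫ T.obj.ofSmash = S.obj.ofSmash ≫ f.hom.p.hom
          have h₁ : S.obj.κ.hom ≫ f.hom.p.hom = f.hom.v.hom ≫ T.obj.κ.hom :=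
            congrArg Bialg.Hom.hom f.hom.κ_comm
          have h₂ : S.obj.e.hom ≫ f.hom.p.hom = f.hom.g.hom ≫ T.obj.e.hom :=
            congrArg Bialg.Hom.hom f.hom.e_comm
          rw [SplitExt.ofSmash, SplitExt.ofSmash, Category.assoc, f.hom.p.mul_hom,
            tensorHom_comp_tensorHom_assoc, tensorHom_comp_tensorHom_assoc, h₁, h₂]) :
        SplitExt.toActAss C ⋙ Act.toSplitExtAss C ≅ 𝟭 _).symm
    (NatIso.ofComponents (fun T => (Act.isAssoc C).isoMk (T.obj.actOfSmashIso T.property))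
      (by
        intro S T f
        apply ObjectProperty.hom_ext
        exact Act.Hom.ext ((Category.comp_id _).trans (Category.id_comp _).symm)
          ((Category.comp_id _).trans (Category.id_comp _).symm)))

end Symmetric

end BialgebraSplitExt

theorem corollary3 (C : Type u) [Category.{v} C] [MonoidalCategory C] [SymmetricCategory C] :
    Nonempty (BialgebraSplitExt.SplitExtAss C ≌ BialgebraSplitExt.ActAss C) :=
  ⟨BialgebraSplitExt.splitExtEquivAct C⟩
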